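/- For $n\ge 0$, let $\mathcal{E}_{\text{phase}}$ be the $n$-qubit phase ensemble, i.e. the law of $$U = H^{\otimes n} \prod_{0\le i<j\le n-1} CZ_{i,j}^{A_{i,j}} \prod_{k} S_k^{A_{k,k}},$$ where $CZ=\operatorname{diag}(1,1,1,-1)$, $S=\operatorname{diag}(1,i)$, $H$ is the Hadamard gate, and $A$ is a uniformly random symmetric binary $n\times n$ matrix (the entries $A_{i,j}$, $i\le j$, are independent fair bits). A Clifford unitary is a unitary $V$ on $n$ qubits with $V^\dagger P V$ in the Pauli group $\{\pm1,\pm i\}\times\{I,X,Y,Z\}^{\otimes n}$ for every $P$ in the Pauli group. For a Pauli group element $P$ let $[P]\in\{I,X,Y,Z\}^{\otimes n}$ be the operator obtained by dropping its phase, and for a Clifford unitary $U$ let $[\mathbf{S}_U]=\{[U^\dagger Z^{\mathbf a}U] : \mathbf a\in\mathbb F_2^n\}$ be the phaseless stabilizer group of the state $U^\dagger|\mathbf 0\rangle$, where $Z^{\mathbf a}=\bigotimes_i Z^{a_i}$. For Clifford $U,V$, let $n_g(U,V)$ be the dimension of the subspace of all $\mathbf a\in\mathbb F_2^n$ with $[UV^\dagger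 Z^{\mathbf a} V U^\dagger]\in\{I,Z\}^{\otimes n}$. **Lemma.** There is an absolute constant $C$ (independent of $n$ and $V$) such that for every $n$ and every $n$-qubit Clifford unitary $V$ the following hold. 1. $|[\mathbf{S}_U]\cap[\mathbf{S}_V]| = 2^{n_g(U,V)}$ for every $U$ in the support of $\mathcal{E}_{\text{phase}}$. 2. $\mathbb{E}_{U\sim\mathcal{E}_{\text{phase}}}\big[2^{n_g(U,V)}\big]\le C$. 3. $\mathbb{P}_{U\sim\mathcal{E}_{\text{phase}}}\big(2^{n_g(U,V)}\ge 2^{c}\big)\le C\,2^{-2c}$ for every real $c>0$. -/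

import Mathlib

open scoped NNReal ENNReal

noncomputable section

namespace PhaseShadow

/-- Computational basis labels `b ∈ {0,1}ⁿ` of an `n`-qubit system. -/
abbrev Basis (n : ℕ) : Type := Fin n → Fin 2

/-- Operators on `n` qubits, as `2ⁿ × 2ⁿ` complex matrices in the computational basis. -/
abbrev Op (n : ℕ) : Type := Matrix (Basis n) (Basis n) ℂ

/-- Unitaries on `n` qubits. -/
abbrev Unitary (n : ℕ) : Type := Matrix.unitaryGroup (Basis n) ℂ

/-- The tensor product `M₀ ⊗ ⋯ ⊗ Mₙ₋₁` of single-qubit operators. -/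
def tensor {n : ℕ} (M : Fin n → Matrix (Fin 2) (Fin 2) ℂ) : Op n :=
  fun x y => ∏ i, M i (x i) (y i)

/-- Pauli `X`. -/
def pauliX : Matrix (Fin 2) (Fin 2) ℂ := !![0, 1; 1, 0]

/-- Pauli `Y`. -/
def pauliY : Matrix (Fin 2) (Fin 2) ℂ := !![0, -Complex.I; Complex.I, 0]

/-- Pauli `Z`. -/
def pauliZ : Matrix (Fin 2) (Fin 2) ℂ := !![1, 0; 0, -1]

/-- The Hadamard gate. -/
def hadamard : Matrix (Fin 2) (Fin 2) ℂ := ((Real.sqrt 2 : ℝ) : ℂ)⁻¹ • !![1, 1; 1, -1]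

/-- The phaseless Pauli operators `{I, X, Y, Z}^{⊗ n}`. -/
def phaselessPaulis (n : ℕ) : Set (Op n) :=
  {P | ∃ M : Fin n → Matrix (Fin 2) (Fin 2) ℂ,
    (∀ i, M i ∈ ({1, pauliX, pauliY, pauliZ} : Set (Matrix (Fin 2) (Fin 2) ℂ))) ∧ P = tensor M}

/-- `IsPhaselessOf M P` says that `M` is a Pauli element, `M = c P` with `c ∈ {±1, ±i}` and
`P ∈ {I, X, Y, Z}^{⊗ n}`, and that `P` is its phaseless Pauli operator `[M]`. -/
def IsPhaselessOf {n : ℕ} (M P : Op n) : Prop :=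
  P ∈ phaselessPaulis n ∧
    ∃ c ∈ ({1, -1, Complex.I, -Complex.I} : Set ℂ), M = c • P

/-- The `n`-qubit Pauli group `{±1, ±i} × {I, X, Y, Z}^{⊗ n}`, as a set of operators. -/
def pauliGroup (n : ℕ) : Set (Op n) := {M | ∃ P, IsPhaselessOf M P}

/-- `U` is a Clifford unitary: `U† P U` is in the Pauli group for every `P` in the Pauli group. -/
def IsClifford {n : ℕ} (U : Unitary n) : Prop :=
  ∀ P ∈ pauliGroup n, star (U : Op n) * P * (U : Op n) ∈ pauliGroup n

/-- `Z^a = ⊗ᵢ Z^{aᵢ}` for a binary vector `a`. -/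
def zString {n : ℕ} (a : Fin n → ZMod 2) : Op n := tensor fun i => pauliZ ^ (a i).val

/-- `{I, Z}^{⊗ n}`, the phaseless Pauli operators in the `Z` basis. -/
def zPaulis (n : ℕ) : Set (Op n) := Set.range zString

/-- The stabilizer group `{U† Z^a U | a}` of the state `U† |0⟩⟨0| U = 2⁻ⁿ ∑ₐ U† Z^a U`. -/
def stabilizers {n : ℕ} (U : Unitary n) : Set (Op n) :=
  Set.range fun a : Fin n → ZMod 2 => star (U : Op n) * zString a * (U : Op n)

/-- The phaseless stabilizer group `{[P] | P a stabilizer}`. -/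
def phaselessStabilizers {n : ℕ} (U : Unitary n) : Set (Op n) :=
  {P | ∃ M ∈ stabilizers U, IsPhaselessOf M P}

theorem tensor_mul {n : ℕ} (M N : Fin n → Matrix (Fin 2) (Fin 2) ℂ) :
    tensor M * tensor N = tensor fun i => M i * N i := by
  ext x y
  simp only [tensor, Matrix.mul_apply, ← Finset.prod_mul_distrib]
  rw [Finset.prod_univ_sum]
  simp

theorem tensor_one {n : ℕ} : tensor (fun _ : Fin n => 1) = 1 := by
  ext x y
  simp only [tensor, Matrix.one_apply, Finset.prod_ite_zero, Finset.prod_const_one]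
  simp [funext_iff]

theorem star_tensor {n : ℕ} (M : Fin n → Matrix (Fin 2) (Fin 2) ℂ) :
    star (tensor M) = tensor fun i => star (M i) := by
  ext x y
  simp [tensor, Matrix.star_apply]

theorem pauliZ_sq : pauliZ * pauliZ = 1 := by
  ext i j; fin_cases i <;> fin_cases j <;> simp [pauliZ]

theorem zString_zero {n : ℕ} : zString (0 : Fin n → ZMod 2) = 1 := by
  simp [zString, tensor_one]

theorem zString_mul {n : ℕ} (a b : Fin n → ZMod 2) :
    zString a * zString b = zString (a + b) := by
  simp only [zString, tensor_mul]
  congr 1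
  funext i
  have key : ∀ s t : ZMod 2,
      pauliZ ^ s.val * pauliZ ^ t.val = pauliZ ^ (s + t).val := by
    intro s t
    fin_cases s <;> fin_cases t
    · change pauliZ ^ 0 * pauliZ ^ 0 = pauliZ ^ 0
      simp
    · change pauliZ ^ 0 * pauliZ ^ 1 = pauliZ ^ 1
      simp
    · change pauliZ ^ 1 * pauliZ ^ 0 = pauliZ ^ 1
      simp
    · change pauliZ ^ 1 * pauliZ ^ 1 = pauliZ ^ 0
      simp [pauliZ_sq]
  exact key _ _

theorem zString_mem {n : ℕ} (a : Fin n → ZMod 2) : zString a ∈ phaselessPaulis n := by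
  refine ⟨_, fun i => ?_, rfl⟩
  have key : ∀ s : ZMod 2,
      pauliZ ^ s.val ∈ ({1, pauliX, pauliY, pauliZ} : Set (Matrix (Fin 2) (Fin 2) ℂ)) := by
    intro s
    fin_cases s
    · change pauliZ ^ 0 ∈ _
      simp
    · change pauliZ ^ 1 ∈ _
      simp
  exact key _

/-- The subspace of all binary vectors `a` with `[U V† Z^a V U†] ∈ {I, Z}^{⊗ n}`. -/
def sharedSubspace {n : ℕ} (U V : Unitary n) : Submodule (ZMod 2) (Fin n → ZMod 2) where
  carrier := {a | ∃ P ∈ zPaulis n, IsPhaselessOf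
    ((U : Op n) * star (V : Op n) * zString a * (V : Op n) * star (U : Op n)) P}
  zero_mem' := by
    refine ⟨zString 0, ⟨0, rfl⟩, zString_mem 0, 1, by simp, ?_⟩
    have hU : (U : Op n) * star (U : Op n) = 1 := Matrix.mem_unitaryGroup_iff.1 U.2
    have hV : star (V : Op n) * (V : Op n) = 1 := Matrix.mem_unitaryGroup_iff'.1 V.2
    simp [zString_zero, mul_assoc (U : Op n), hU, hV]
  add_mem' := by
    rintro a b ⟨_, ⟨a', rfl⟩, _, c, hc, h⟩ ⟨_, ⟨b', rfl⟩, _, d, hd, k⟩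
    refine ⟨zString (a' + b'), ⟨_, rfl⟩, zString_mem _, c * d, ?_, ?_⟩
    · simp only [Set.mem_insert_iff, Set.mem_singleton_iff] at hc hd ⊢
      rcases hc with rfl | rfl | rfl | rfl <;> rcases hd with rfl | rfl | rfl | rfl <;> simp
    · have hU : star (U : Op n) * (U : Op n) = 1 := Matrix.mem_unitaryGroup_iff'.1 U.2
      have hV : (V : Op n) * star (V : Op n) = 1 := Matrix.mem_unitaryGroup_iff.1 V.2
      have e : (U : Op n) * star (V : Op n) * zString (a + b) * (V : Op n) * star (U : Op n)
          = ((U : Op n) * star (V : Op n) * zString a * (V : Op n) * star (U : Op n)) *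
            ((U : Op n) * star (V : Op n) * zString b * (V : Op n) * star (U : Op n)) := by
        rw [← zString_mul]
        simp only [mul_assoc]
        rw [← mul_assoc (star (U : Op n)) (U : Op n), hU, one_mul,
          ← mul_assoc (V : Op n) (star (V : Op n)), hV, one_mul]
      rw [e, h, k, smul_mul_smul_comm, zString_mul]
  smul_mem' := by
    intro s a h
    have key : s = 0 ∨ s = 1 := by
      fin_cases s
      · exact Or.inl rfl
      · exact Or.inr rfl
    rcases key with rfl | rfl
    · refine ⟨zString 0, ⟨0, rfl⟩, zString_mem 0, 1, by simp, ?_⟩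
      have hU : (U : Op n) * star (U : Op n) = 1 := Matrix.mem_unitaryGroup_iff.1 U.2
      have hV : star (V : Op n) * (V : Op n) = 1 := Matrix.mem_unitaryGroup_iff'.1 V.2
      simp [zString_zero, mul_assoc (U : Op n), hU, hV]
    · simpa using h

/-- The rank `n_g(U, V)`. -/
def nG {n : ℕ} (U V : Unitary n) : ℕ := Module.finrank (ZMod 2) (sharedSubspace U V)

/-- Diagonal entries of the gate `CZ = diag(1, 1, 1, -1)` on the qubits `i`, `j`. -/
def czDiag {n : ℕ} (i j : Fin n) : Basis n → ℂ := fun x => if x i = 1 ∧ x j = 1 then -1 else 1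

/-- Diagonal entries of the gate `S = diag(1, i)` on the qubit `k`. -/
def sDiag {n : ℕ} (k : Fin n) : Basis n → ℂ := fun x => if x k = 1 then Complex.I else 1

/-- Diagonal entries of `∏_{i<j} CZ_{i,j}^{A_{i,j}} ∏_k S_k^{A_{k,k}}`. All gates are diagonal, so
the product of the gates is the diagonal matrix of the entrywise products. -/
def phaseDiag {n : ℕ} (A : Matrix (Fin n) (Fin n) (ZMod 2)) : Basis n → ℂ :=
  (∏ p : Fin n × Fin n with p.1 < p.2, czDiag p.1 p.2 ^ (A p.1 p.2).val) *
    ∏ k, sDiag k ^ (A k k).val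

theorem star_mul_phaseDiag {n : ℕ} (A : Matrix (Fin n) (Fin n) (ZMod 2)) :
    star (phaseDiag A) * phaseDiag A = 1 := by
  have h1 : ∀ i j : Fin n, czDiag i j ∈ unitary (Basis n → ℂ) := by
    intro i j
    rw [Unitary.mem_iff]
    constructor <;> funext x <;> by_cases h : x i = 1 ∧ x j = 1 <;> simp [czDiag, h]
  have h2 : ∀ k : Fin n, sDiag k ∈ unitary (Basis n → ℂ) := by
    intro k
    rw [Unitary.mem_iff]
    constructor <;> funext x <;> by_cases h : x k = 1 <;> simp [sDiag, h]
  have h3 : phaseDiag A ∈ unitary (Basis n → ℂ) :=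
    mul_mem (prod_mem fun p _ => pow_mem (h1 _ _) _) (prod_mem fun k _ => pow_mem (h2 _) _)
  exact (Unitary.mem_iff.1 h3).1

theorem hadamard_star_mul : star hadamard * hadamard = 1 := by
  have h : ((Real.sqrt 2 : ℝ) : ℂ)⁻¹ * ((Real.sqrt 2 : ℝ) : ℂ)⁻¹ = 1 / 2 := by
    rw [← mul_inv, ← Complex.ofReal_mul, Real.mul_self_sqrt (by norm_num)]
    norm_num
  ext i j
  fin_cases i <;> fin_cases j <;>
    simp [hadamard, Matrix.mul_apply, Matrix.star_apply, h] <;> norm_num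

/-- The phase circuit `H^{⊗ n} U_A` with `U_A = ∏_{i<j} CZ_{i,j}^{A_{i,j}} ∏_k S_k^{A_{k,k}}`. -/
def phaseUnitary {n : ℕ} (A : Matrix (Fin n) (Fin n) (ZMod 2)) : Unitary n :=
  ⟨tensor (fun _ => hadamard) * Matrix.diagonal (phaseDiag A), by
    rw [Matrix.mem_unitaryGroup_iff', star_mul, mul_assoc, ← mul_assoc (star (tensor _)),
      star_tensor, tensor_mul]
    simp only [hadamard_star_mul, tensor_one, one_mul]
    rw [Matrix.star_eq_conjTranspose, Matrix.diagonal_conjTranspose, Matrix.diagonal_mul_diagonal']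
    exact (congrArg Matrix.diagonal (star_mul_phaseDiag A)).trans Matrix.diagonal_one⟩

instance symmNonempty (n : ℕ) : Nonempty {A : Matrix (Fin n) (Fin n) (ZMod 2) // A.IsSymm} :=
  ⟨⟨0, Matrix.isSymm_zero⟩⟩

/-- The phase ensemble: the law of `H^{⊗ n} U_A` for a uniformly random symmetric binary matrix `A`
(that is, the entries `A_{i,j}` with `i ≤ j` are independent fair bits). -/
def phaseEnsemble (n : ℕ) : PMF (Unitary n) :=
  (PMF.uniformOfFintype {A : Matrix (Fin n) (Fin n) (ZMod 2) // A.IsSymm}).map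
    fun A => phaseUnitary A.1

end PhaseShadow

end

namespace PhaseShadow

open Finset Matrix

/-! Up to phase, every Pauli operator is `X^x Z^z` for a unique label `(x, z)`. The diagonal of a
phase circuit is a quadratic phase whose polarization is the form of `A`, so conjugating `Z^b` by
the circuit gives the label `(b, A b)`: its stabilizers are exactly the graph of `A`
(`isWeyl_phaseUnitary_conj`). The stabilizers of `V` have a set `T` of at most `2 ^ n` labels, so `2
^ n_g` is at most the number of points of `T` on the graph of `A` (`exists_graph_bound`).

What remains is a second moment over random symmetric `A`. For distinct nonzero `x`, `y`, symmetry
imposes only the one relation `y ⬝ A x = x ⬝ A y`, so `A x` and `A y` take prescribed values with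
probability at most `2 / 4 ^ n` (`card_mulVec_eq_and_le`). Such pairs from `T` contribute at most 2.
A pair that is not of this kind can lie on a graph only if one point is the origin or the two
coincide, which costs three first moments of at most 2 each. Hence `E[4 ^ n_g] ≤ 8`; this bounds the
mean, and Markov's inequality applied to `4 ^ n_g` gives the tail. Only the size of `T` matters, not
its group structure. -/

/-! ### Symmetric matrices over `ZMod 2` with prescribed values -/

/-- The symmetric matrix `u fᵀ + f uᵀ - (u ⬝ y) f fᵀ`, which maps `y` to `u` when `f ⬝ y = 1`. -/
def symSection {n : ℕ} (f y u : Fin n → ZMod 2) : Matrix (Fin n) (Fin n) (ZMod 2) :=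
  vecMulVec u f + vecMulVec f u - (u ⬝ᵥ y) • vecMulVec f f

theorem symSection_isSymm {n : ℕ} (f y u : Fin n → ZMod 2) : (symSection f y u).IsSymm := by
  ext i j
  simp only [symSection, Matrix.transpose_apply, Matrix.sub_apply, Matrix.add_apply,
    Matrix.smul_apply, vecMulVec_apply, smul_eq_mul]
  ring

theorem symSection_mulVec {n : ℕ} (f y u v : Fin n → ZMod 2) :
    symSection f y u *ᵥ v = (f ⬝ᵥ v) • u + (u ⬝ᵥ v) • f - ((u ⬝ᵥ y) * (f ⬝ᵥ v)) • f := by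
  funext i
  simp only [symSection, Matrix.sub_mulVec, Matrix.add_mulVec, Matrix.smul_mulVec,
    vecMulVec_mulVec, Pi.sub_apply, Pi.add_apply, Pi.smul_apply, smul_eq_mul, op_smul_eq_smul]
  ring

theorem symSection_mulVec_self {n : ℕ} {f y : Fin n → ZMod 2} (u : Fin n → ZMod 2)
    (h : f ⬝ᵥ y = 1) : symSection f y u *ᵥ y = u := by
  rw [symSection_mulVec, h]; simp

theorem symSection_mulVec_of_orthogonal {n : ℕ} {f y u v : Fin n → ZMod 2}
    (hf : f ⬝ᵥ v = 0) (hu : u ⬝ᵥ v = 0) : symSection f y u *ᵥ v = 0 := by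
  rw [symSection_mulVec, hf, hu]; simp

theorem zmod_two_eq_one {s : ZMod 2} (h : s ≠ 0) : s = 1 := by
  revert s; decide

theorem exists_dotProduct_eq_one {n : ℕ} {x : Fin n → ZMod 2} (hx : x ≠ 0) :
    ∃ f, f ⬝ᵥ x = 1 := by
  obtain ⟨i, hi⟩ := Function.ne_iff.1 hx
  exact ⟨Pi.single i 1, by simpa using zmod_two_eq_one hi⟩

/-- Over `ZMod 2`, distinct nonzero vectors are linearly independent, so a functional can separate
them. A coordinate works unless the support of `y` lies inside that of `x`; then one coordinate in
each of `supp y` and `supp x \ supp y` are added, and they cancel on `x`. -/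
theorem exists_dotProduct_eq_zero_one {n : ℕ} {x y : Fin n → ZMod 2} (hy : y ≠ 0)
    (hxy : x ≠ y) : ∃ g, g ⬝ᵥ x = 0 ∧ g ⬝ᵥ y = 1 := by
  by_cases h : ∃ i, y i ≠ 0 ∧ x i = 0
  · obtain ⟨i, hi, hxi⟩ := h
    exact ⟨Pi.single i 1, by simpa using hxi, by simpa using zmod_two_eq_one hi⟩
  · push Not at h
    obtain ⟨i, hi⟩ := Function.ne_iff.1 hy
    obtain ⟨j, hj⟩ := Function.ne_iff.1 hxy
    have hyj : y j = 0 := by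
      by_contra hyj
      exact hj (by rw [zmod_two_eq_one hyj, zmod_two_eq_one (h j hyj)])
    have hxj : x j = 1 := zmod_two_eq_one (by rwa [hyj] at hj)
    have hxi := zmod_two_eq_one (h i hi)
    have hyi := zmod_two_eq_one hi
    refine ⟨Pi.single i 1 + Pi.single j 1, ?_, ?_⟩
    · simp only [add_dotProduct, single_dotProduct, hxi, hxj]
      decide
    · simp [add_dotProduct, hyi, hyj]

/-! ### Counting symmetric matrices through given points -/

/-- The symmetric binary matrices. -/
abbrev SymMat (n : ℕ) : Type := {A : Matrix (Fin n) (Fin n) (ZMod 2) // A.IsSymm}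

/-- Adding `symSection f x u` to a solution shifts `A x` by `u`, so the `2 ^ n` translates of the
solution set are disjoint. -/
theorem card_mulVec_eq_le {n : ℕ} {x : Fin n → ZMod 2} (hx : x ≠ 0) (z : Fin n → ZMod 2) :
    2 ^ n * #{A : SymMat n | A.1 *ᵥ x = z} ≤ Fintype.card (SymMat n) := by
  obtain ⟨f, hf⟩ := exists_dotProduct_eq_one hx
  let Φ : (Fin n → ZMod 2) × {A : SymMat n // A.1 *ᵥ x = z} → SymMat n :=
    fun q => ⟨q.2.1.1 + symSection f x q.1, q.2.1.2.add (symSection_isSymm f x q.1)⟩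
  have hΦ : Function.Injective Φ := by
    rintro ⟨u, A, hA⟩ ⟨v, B, hB⟩ h
    have h1 : A.1 + symSection f x u = B.1 + symSection f x v := congrArg Subtype.val h
    have h2 := congrArg (· *ᵥ x) h1
    simp only [Matrix.add_mulVec, hA, hB, symSection_mulVec_self _ hf, add_right_inj] at h2
    subst h2
    have h3 : A = B := Subtype.ext (add_right_cancel h1)
    subst h3
    rfl
  have := Fintype.card_le_of_injective Φ hΦ
  simpa [Fintype.card_subtype] using this

/-- Translation again, now by two corrections. The factor 2 is the price of symmetry: once `A x` is
fixed, `A y` can be shifted only by vectors orthogonal to `x`. -/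
theorem card_mulVec_eq_and_le {n : ℕ} {x y : Fin n → ZMod 2} (hx : x ≠ 0) (hy : y ≠ 0)
    (hxy : x ≠ y) (z w : Fin n → ZMod 2) :
    4 ^ n * #{A : SymMat n | A.1 *ᵥ x = z ∧ A.1 *ᵥ y = w} ≤ 2 * Fintype.card (SymMat n) := by
  obtain ⟨f, hf⟩ := exists_dotProduct_eq_one hx
  obtain ⟨g, hgx, hgy⟩ := exists_dotProduct_eq_zero_one hy hxy
  -- A projection onto the vectors orthogonal to `x`. With `g ⬝ x = 0` it makes the second
  -- correction kill `x`, so `u` is read off from the value at `x`, then `ρ v` from the value at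
  -- `y`. The lost bit `v ⬝ x` is stored in the `ZMod 2` factor.
  let ρ : (Fin n → ZMod 2) → Fin n → ZMod 2 := fun v => v - (v ⬝ᵥ x) • f
  have hρ : ∀ v, ρ v ⬝ᵥ x = 0 := fun v => by
    simp only [ρ, sub_dotProduct, smul_dotProduct, hf, smul_eq_mul, mul_one, sub_self]
  let Φ : (Fin n → ZMod 2) × (Fin n → ZMod 2) ×
      {A : SymMat n // A.1 *ᵥ x = z ∧ A.1 *ᵥ y = w} → ZMod 2 × SymMat n :=
    fun q => (q.2.1 ⬝ᵥ x, ⟨q.2.2.1.1 + symSection f x q.1 + symSection g y (ρ q.2.1),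
      (q.2.2.1.2.add (symSection_isSymm _ _ _)).add (symSection_isSymm _ _ _)⟩)
  have hΦ : Function.Injective Φ := by
    rintro ⟨u, v, A, hA, hA'⟩ ⟨u', v', B, hB, hB'⟩ h
    have h0 : v ⬝ᵥ x = v' ⬝ᵥ x := congrArg Prod.fst h
    have h1 : A.1 + symSection f x u + symSection g y (ρ v)
        = B.1 + symSection f x u' + symSection g y (ρ v') :=
      congrArg (fun q => q.2.1) h
    have h2 := congrArg (· *ᵥ x) h1
    simp only [Matrix.add_mulVec, hA, hB, symSection_mulVec_self _ hf, add_zero,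
      symSection_mulVec_of_orthogonal hgx (hρ _), add_right_inj] at h2
    subst h2
    have h3 := congrArg (· *ᵥ y) h1
    simp only [Matrix.add_mulVec, hA', hB', symSection_mulVec_self _ hgy, add_right_inj] at h3
    have h4 : v = v' := by
      simp only [ρ, h0] at h3
      exact sub_left_injective h3
    subst h4
    have h5 : A = B := Subtype.ext (add_right_cancel (add_right_cancel h1))
    subst h5
    rfl
  have := Fintype.card_le_of_injective Φ hΦ
  simp only [Fintype.card_prod, Fintype.card_pi, ZMod.card, prod_const, card_univ,
    Fintype.card_fin, Fintype.card_subtype] at this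
  rw [show 4 = 2 * 2 by rfl, mul_pow, mul_assoc]
  simpa [Fintype.card_subtype] using this

/-- The origin lies on every graph and costs one full `N`; points `(0, z)` with `z ≠ 0` lie on none;
the others together cost at most another `N`. -/
theorem sum_card_mulVec_eq_le {n : ℕ} (T : Finset ((Fin n → ZMod 2) × (Fin n → ZMod 2)))
    (hT : #T ≤ 2 ^ n) :
    ∑ p ∈ T, #{A : SymMat n | A.1 *ᵥ p.1 = p.2} ≤ 2 * Fintype.card (SymMat n) := by
  set N := Fintype.card (SymMat n)
  have h : ∀ p ∈ T, 2 ^ n * #{A : SymMat n | A.1 *ᵥ p.1 = p.2}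
      ≤ N + if p = 0 then 2 ^ n * N else 0 := by
    rintro ⟨x, z⟩ -
    by_cases hx : x = 0
    · subst hx
      by_cases hz : z = 0
      · subst hz
        simp only [Matrix.mulVec_zero, Prod.mk_zero_zero, if_true]
        exact le_add_left (Nat.mul_le_mul_left _ (card_le_univ _))
      · simp [Ne.symm hz]
    · exact le_add_right (card_mulVec_eq_le hx z)
  have h2 := sum_le_sum h
  rw [← mul_sum, sum_add_distrib, sum_const, smul_eq_mul, sum_ite_eq'] at h2
  have h3 : #T * N ≤ 2 ^ n * N := Nat.mul_le_mul_right _ hT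
  have h4 : (if 0 ∈ T then 2 ^ n * N else 0) ≤ 2 ^ n * N := by split_ifs <;> simp
  refine Nat.le_of_mul_le_mul_left (c := 2 ^ n) ?_ (by positivity)
  linarith

/-- On a graph the first coordinate determines the point, so coinciding or vanishing first
coordinates force `p = q`, `p = 0` or `q = 0`, and a single-point count then suffices. -/
theorem card_pair_le {n : ℕ} (p q : (Fin n → ZMod 2) × (Fin n → ZMod 2)) :
    4 ^ n * #{A : SymMat n | A.1 *ᵥ p.1 = p.2 ∧ A.1 *ᵥ q.1 = q.2}
      ≤ 2 * Fintype.card (SymMat n) + 4 ^ n *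
        ((if p = 0 then #{A : SymMat n | A.1 *ᵥ q.1 = q.2} else 0) +
        (if q = 0 then #{A : SymMat n | A.1 *ᵥ p.1 = p.2} else 0) +
        (if p = q then #{A : SymMat n | A.1 *ᵥ p.1 = p.2} else 0)) := by
  have hl : #{A : SymMat n | A.1 *ᵥ p.1 = p.2 ∧ A.1 *ᵥ q.1 = q.2}
      ≤ #{A : SymMat n | A.1 *ᵥ p.1 = p.2} :=
    card_le_card (monotone_filter_right _ fun _ _ h => h.1)
  have hr : #{A : SymMat n | A.1 *ᵥ p.1 = p.2 ∧ A.1 *ᵥ q.1 = q.2}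
      ≤ #{A : SymMat n | A.1 *ᵥ q.1 = q.2} :=
    card_le_card (monotone_filter_right _ fun _ _ h => h.2)
  by_cases he : ∃ A : SymMat n, A.1 *ᵥ p.1 = p.2 ∧ A.1 *ᵥ q.1 = q.2
  swap
  · rw [filter_eq_empty_iff.2 fun A _ h => he ⟨A, h⟩]; simp
  obtain ⟨A, hp, hq⟩ := he
  by_cases h1 : p.1 = 0
  · have : p = 0 := Prod.ext h1 (by rw [← hp, h1, Matrix.mulVec_zero]; rfl)
    rw [if_pos this]
    exact le_add_left (Nat.mul_le_mul_left _ (by omega))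
  by_cases h2 : q.1 = 0
  · have : q = 0 := Prod.ext h2 (by rw [← hq, h2, Matrix.mulVec_zero]; rfl)
    rw [if_pos this]
    exact le_add_left (Nat.mul_le_mul_left _ (by omega))
  by_cases h3 : p.1 = q.1
  · have : p = q := Prod.ext h3 (by rw [← hq, ← hp, h3])
    rw [if_pos this]
    exact le_add_left (Nat.mul_le_mul_left _ (by omega))
  exact le_add_right (card_mulVec_eq_and_le h1 h2 h3 _ _)

/-- Second moment of the number of points of a set of size at most `2 ^ n` on the graph of a
random symmetric matrix. -/
theorem sum_card_graph_sq_le {n : ℕ} (T : Finset ((Fin n → ZMod 2) × (Fin n → ZMod 2)))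
    (hT : #T ≤ 2 ^ n) :
    ∑ A : SymMat n, #{p ∈ T | A.1 *ᵥ p.1 = p.2} ^ 2 ≤ 8 * Fintype.card (SymMat n) := by
  set N := Fintype.card (SymMat n)
  have hS := sum_card_mulVec_eq_le T hT
  set S := ∑ p ∈ T, #{A : SymMat n | A.1 *ᵥ p.1 = p.2}
  have e : ∑ A : SymMat n, #{p ∈ T | A.1 *ᵥ p.1 = p.2} ^ 2
      = ∑ p ∈ T, ∑ q ∈ T, #{A : SymMat n | A.1 *ᵥ p.1 = p.2 ∧ A.1 *ᵥ q.1 = q.2} := by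
    simp only [card_filter, sq, sum_mul_sum, ← ite_and, mul_ite, mul_one, mul_zero]
    rw [sum_comm]
    refine sum_congr rfl fun p _ => ?_
    rw [sum_comm]
    refine sum_congr rfl fun q _ => sum_congr rfl fun A _ => ?_
    simp only [and_comm]
  have h := sum_le_sum fun p (_ : p ∈ T) => sum_le_sum fun q (_ : q ∈ T) => card_pair_le p q
  have hT2 : 2 * (#T * (#T * N)) ≤ 4 ^ n * (2 * N) := by
    rw [← mul_assoc (#T), mul_left_comm, show 4 = 2 * 2 by rfl, mul_pow]
    exact Nat.mul_le_mul_right _ (Nat.mul_le_mul hT hT)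
  have h1 : ∑ p ∈ T, ∑ q ∈ T, (if p = 0 then #{A : SymMat n | A.1 *ᵥ q.1 = q.2} else 0) ≤ S := by
    rw [sum_comm]
    refine sum_le_sum fun q _ => ?_
    rw [sum_ite_eq']; split_ifs <;> simp
  have h2 : ∑ p ∈ T, ∑ q ∈ T, (if q = 0 then #{A : SymMat n | A.1 *ᵥ p.1 = p.2} else 0) ≤ S := by
    refine sum_le_sum fun q _ => ?_
    rw [sum_ite_eq']; split_ifs <;> simp
  have h3 : ∑ p ∈ T, ∑ q ∈ T, (if p = q then #{A : SymMat n | A.1 *ᵥ p.1 = p.2} else 0) ≤ S := by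
    refine sum_le_sum fun p hp => ?_
    rw [sum_ite_eq, if_pos hp]
  rw [e]
  refine Nat.le_of_mul_le_mul_left (c := 4 ^ n) ?_ (by positivity)
  simp only [← mul_sum, sum_add_distrib, sum_const, smul_eq_mul] at h
  -- The constant is `8 = 2 + 3 * 2`: generic pairs, plus three degenerate families each bounded by
  -- the first moment `S ≤ 2 * N`.
  calc _ ≤ _ := h
    _ ≤ 4 ^ n * (2 * N) + 4 ^ n * (2 * N + 2 * N + 2 * N) :=
      add_le_add hT2 (Nat.mul_le_mul_left _ (by omega))
    _ = _ := by ring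

/-! ### Pauli operators and their Weyl labels -/

/-- The sign character `s ↦ (-1)^s` of `ZMod 2`. -/
def signChar (s : ZMod 2) : ℂ := if s = 0 then 1 else -1

theorem zmod_two_cases (s : ZMod 2) : s = 0 ∨ s = 1 := by
  revert s; decide

theorem signChar_zero : signChar 0 = 1 := by simp [signChar]

theorem signChar_add (s t : ZMod 2) : signChar (s + t) = signChar s * signChar t := by
  have h : (1 : ZMod 2) + 1 = 0 := rfl
  rcases zmod_two_cases s with rfl | rfl <;> rcases zmod_two_cases t with rfl | rfl <;>
    simp [signChar, h]

theorem signChar_sum {ι : Type*} (S : Finset ι) (f : ι → ZMod 2) :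
    signChar (∑ i ∈ S, f i) = ∏ i ∈ S, signChar (f i) := by
  classical
  induction S using Finset.induction_on with
  | empty => simp [signChar_zero]
  | insert i S hi ih => rw [sum_insert hi, prod_insert hi, signChar_add, ih]

theorem signChar_injective : Function.Injective signChar := by
  intro s t h
  rcases zmod_two_cases s with rfl | rfl <;> rcases zmod_two_cases t with rfl | rfl <;>
    first | rfl | norm_num [signChar] at h

/-- The bit in `Fin 2` of an element of `ZMod 2`. -/
def toBit (s : ZMod 2) : Fin 2 := if s = 0 then 0 else 1

theorem toBit_zero : toBit 0 = 0 := by simp [toBit]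

theorem toBit_one : toBit 1 = 1 := by simp [toBit]

/-- The computational basis label of a binary vector. -/
def bits {n : ℕ} (x : Fin n → ZMod 2) : Basis n := fun i => toBit (x i)

/-- `M` is a nonzero multiple of `X^x Z^z`. -/
def IsWeyl {n : ℕ} (M : Op n) (x z : Fin n → ZMod 2) : Prop :=
  ∃ κ : ℂ, κ ≠ 0 ∧ ∀ t s : Fin n → ZMod 2,
    M (bits t) (bits s) = if t = s + x then κ * signChar (z ⬝ᵥ s) else 0

theorem IsWeyl.smul {n : ℕ} {M : Op n} {x z : Fin n → ZMod 2} (h : IsWeyl M x z) {c : ℂ}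
    (hc : c ≠ 0) : IsWeyl (c • M) x z := by
  obtain ⟨κ, hκ, h⟩ := h
  refine ⟨c * κ, mul_ne_zero hc hκ, fun t s => ?_⟩
  rw [Matrix.smul_apply, h t s, smul_eq_mul, mul_ite, mul_zero, mul_assoc]

/-- Column `0` has its only nonzero entry in row `x`; comparing it with column `e_i` then reveals
the sign of `z i`. -/
theorem IsWeyl.unique {n : ℕ} {M : Op n} {x z x' z' : Fin n → ZMod 2} (h : IsWeyl M x z)
    (h' : IsWeyl M x' z') : x = x' ∧ z = z' := by
  obtain ⟨κ, hκ, h⟩ := h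
  obtain ⟨κ', hκ', h'⟩ := h'
  have h0 := (h x 0).symm.trans (h' x 0)
  simp only [zero_add, if_true, dotProduct_zero, signChar_zero, mul_one] at h0
  have hx : x = x' := by
    by_contra hx
    rw [if_neg hx] at h0
    exact hκ h0
  subst hx
  rw [if_pos rfl] at h0
  subst h0
  refine ⟨rfl, funext fun i => ?_⟩
  have h1 := (h (Pi.single i 1 + x) (Pi.single i 1)).symm.trans
    (h' (Pi.single i 1 + x) (Pi.single i 1))
  simp only [if_true, dotProduct_single, mul_one] at h1
  exact signChar_injective (mul_left_cancel₀ hκ h1)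

/-- The single-qubit Pauli matrix with labels `x`, `z`. -/
def pauliMat (x z : ZMod 2) : Matrix (Fin 2) (Fin 2) ℂ :=
  if x = 0 then if z = 0 then 1 else pauliZ else if z = 0 then pauliX else pauliY

/-- The phaseless Pauli operator with labels `x`, `z`. -/
def pauliString {n : ℕ} (x z : Fin n → ZMod 2) : Op n := tensor fun i => pauliMat (x i) (z i)

theorem exists_eq_pauliMat {σ : Matrix (Fin 2) (Fin 2) ℂ}
    (h : σ ∈ ({1, pauliX, pauliY, pauliZ} : Set (Matrix (Fin 2) (Fin 2) ℂ))) :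
    ∃ x z, σ = pauliMat x z := by
  simp only [Set.mem_insert_iff, Set.mem_singleton_iff] at h
  rcases h with rfl | rfl | rfl | rfl
  · exact ⟨0, 0, by simp [pauliMat]⟩
  · exact ⟨1, 0, by simp [pauliMat]⟩
  · exact ⟨1, 1, by simp [pauliMat]⟩
  · exact ⟨0, 1, by simp [pauliMat]⟩

theorem exists_eq_pauliString {n : ℕ} {P : Op n} (h : P ∈ phaselessPaulis n) :
    ∃ x z, P = pauliString x z := by
  obtain ⟨M, hM, rfl⟩ := h
  choose x z hxz using fun i => exists_eq_pauliMat (hM i)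
  exact ⟨x, z, by rw [pauliString, funext hxz]⟩

theorem zString_eq_pauliString {n : ℕ} (a : Fin n → ZMod 2) : zString a = pauliString 0 a := by
  rw [zString, pauliString]
  congr 1
  funext i
  rcases zmod_two_cases (a i) with h | h <;> simp [h, pauliMat]
  rw [show ZMod.val (1 : ZMod 2) = 1 from rfl, pow_one]

theorem pauliString_apply {n : ℕ} (x z : Fin n → ZMod 2) (t s : Basis n) :
    pauliString x z t s = ∏ i, pauliMat (x i) (z i) (t i) (s i) := rfl

theorem pauliMat_zero_zero : pauliMat 0 0 = 1 := by simp [pauliMat]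

theorem pauliMat_zero_one : pauliMat 0 1 = pauliZ := by simp [pauliMat]

theorem pauliMat_one_zero : pauliMat 1 0 = pauliX := by simp [pauliMat]

theorem pauliMat_one_one : pauliMat 1 1 = pauliY := by simp [pauliMat]

theorem pauliMat_apply (x z t s : ZMod 2) :
    pauliMat x z (toBit t) (toBit s) =
      if t = s + x then pauliMat x z (toBit x) 0 * signChar (z * s) else 0 := by
  have h : (1 : ZMod 2) + 1 = 0 := rfl
  rcases zmod_two_cases x with rfl | rfl <;> rcases zmod_two_cases z with rfl | rfl <;>
  rcases zmod_two_cases t with rfl | rfl <;> rcases zmod_two_cases s with rfl | rfl <;>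
    simp [pauliMat_zero_zero, pauliMat_zero_one, pauliMat_one_zero,
      pauliMat_one_one, pauliX, pauliY, pauliZ, signChar, h, toBit_zero, toBit_one]

theorem pauliMat_ne_zero (x z : ZMod 2) : pauliMat x z (toBit x) 0 ≠ 0 := by
  rcases zmod_two_cases x with rfl | rfl <;> rcases zmod_two_cases z with rfl | rfl <;>
    simp [pauliMat_zero_zero, pauliMat_zero_one, pauliMat_one_zero,
      pauliMat_one_one, pauliX, pauliY, pauliZ, toBit_zero, toBit_one]

theorem isWeyl_pauliString {n : ℕ} (x z : Fin n → ZMod 2) : IsWeyl (pauliString x z) x z := by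
  refine ⟨∏ i, pauliMat (x i) (z i) (toBit (x i)) 0,
    prod_ne_zero_iff.2 fun i _ => pauliMat_ne_zero _ _, fun t s => ?_⟩
  have h : pauliString x z (bits t) (bits s) = ∏ i, if t i = s i + x i then
      pauliMat (x i) (z i) (toBit (x i)) 0 * signChar (z i * s i) else 0 := by
    rw [pauliString_apply]
    exact prod_congr rfl fun i _ => pauliMat_apply (x i) (z i) (t i) (s i)
  rw [h, prod_ite_zero, prod_mul_distrib, dotProduct, signChar_sum]
  simp only [mem_univ, true_implies, funext_iff, Pi.add_apply]

/-! ### Phase circuits as quadratic phases -/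

theorem czDiag_pow_apply {n : ℕ} (i j : Fin n) (a : ZMod 2) (x : Fin n → ZMod 2) :
    (czDiag i j ^ a.val : Basis n → ℂ) (bits x) = signChar (a * (x i * x j)) := by
  have e : czDiag i j (bits x) = if toBit (x i) = 1 ∧ toBit (x j) = 1 then -1 else 1 := rfl
  rw [Pi.pow_apply, e]
  have h1 : ZMod.val (1 : ZMod 2) = 1 := rfl
  have h2 : ZMod.val (0 : ZMod 2) = 0 := rfl
  rcases zmod_two_cases a with rfl | rfl <;> rcases zmod_two_cases (x i) with h | h <;>
    rcases zmod_two_cases (x j) with h' | h' <;> rw [h, h'] <;> simp [signChar, toBit, h1, h2]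

/-- Since `i * i = -1`, the map `x ↦ i^x` on bits fails to be a character exactly by `(-1)^(x y)`.
This is how the diagonal of `A` enters the bilinear form. -/
theorem sDiag_pow_apply_add {n : ℕ} (k : Fin n) (a : ZMod 2) (x y : Fin n → ZMod 2) :
    (sDiag k ^ a.val : Basis n → ℂ) (bits (x + y)) =
      (sDiag k ^ a.val : Basis n → ℂ) (bits x) * (sDiag k ^ a.val : Basis n → ℂ) (bits y) *
        signChar (a * (x k * y k)) := by
  have e : ∀ x : Fin n → ZMod 2, sDiag k (bits x) = if toBit (x k) = 1 then Complex.I else 1 :=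
    fun _ => rfl
  rw [Pi.pow_apply, Pi.pow_apply, Pi.pow_apply, e, e, e, Pi.add_apply]
  have h1 : ZMod.val (1 : ZMod 2) = 1 := rfl
  have h2 : ZMod.val (0 : ZMod 2) = 0 := rfl
  have h3 : (1 : ZMod 2) + 1 = 0 := rfl
  rcases zmod_two_cases a with rfl | rfl <;> rcases zmod_two_cases (x k) with h | h <;>
    rcases zmod_two_cases (y k) with h' | h' <;> rw [h, h'] <;> simp [signChar, toBit, h1, h2, h3]

/-- The `CZ` gates supply the two off-diagonal triangles, matched by symmetry of `A`, and the `S`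
gates supply the diagonal. -/
theorem sum_lt_add_sum_diag {n : ℕ} {A : Matrix (Fin n) (Fin n) (ZMod 2)} (hA : A.IsSymm)
    (x y : Fin n → ZMod 2) :
    ∑ p : Fin n × Fin n with p.1 < p.2, A p.1 p.2 * (x p.1 * y p.2 + y p.1 * x p.2) +
      ∑ k, A k k * (x k * y k) = (A *ᵥ y) ⬝ᵥ x := by
  have e : (A *ᵥ y) ⬝ᵥ x = ∑ p : Fin n × Fin n, A p.1 p.2 * (x p.1 * y p.2) := by
    simp only [dotProduct, mulVec, sum_mul, Fintype.sum_prod_type]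
    exact sum_congr rfl fun i _ => sum_congr rfl fun j _ => by ring
  have hd : ∑ k, A k k * (x k * y k)
      = ∑ p : Fin n × Fin n with p.1 = p.2, A p.1 p.2 * (x p.1 * y p.2) := by
    rw [sum_filter, Fintype.sum_prod_type]
    simp
  have hs : ∑ p : Fin n × Fin n with p.1 < p.2, A p.1 p.2 * (y p.1 * x p.2)
      = ∑ p : Fin n × Fin n with p.2 < p.1, A p.1 p.2 * (x p.1 * y p.2) := by
    refine sum_equiv (Equiv.prodComm _ _) (by simp) fun p _ => ?_
    simp only [Equiv.prodComm_apply, Prod.fst_swap, Prod.snd_swap, hA.apply p.1 p.2]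
    ring
  simp only [mul_add, sum_add_distrib]
  rw [e, hs, hd]
  simp only [sum_filter, ← sum_add_distrib]
  refine sum_congr rfl fun p _ => ?_
  rcases lt_trichotomy p.1 p.2 with h | h | h
  · simp [h, h.ne, h.not_gt]
  · simp [h]
  · simp [h, h.ne', h.not_gt]

theorem phaseDiag_add {n : ℕ} {A : Matrix (Fin n) (Fin n) (ZMod 2)} (hA : A.IsSymm)
    (x y : Fin n → ZMod 2) :
    phaseDiag A (bits (x + y)) =
      phaseDiag A (bits x) * phaseDiag A (bits y) * signChar ((A *ᵥ y) ⬝ᵥ x) := by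
  have e : ∀ x : Fin n → ZMod 2, phaseDiag A (bits x) =
      (∏ p : Fin n × Fin n with p.1 < p.2, signChar (A p.1 p.2 * (x p.1 * x p.2))) *
        ∏ k, (sDiag k ^ (A k k).val : Basis n → ℂ) (bits x) := fun x => by
    rw [phaseDiag, Pi.mul_apply, Finset.prod_apply, Finset.prod_apply]
    simp only [czDiag_pow_apply]
  rw [e, e, e, ← sum_lt_add_sum_diag hA, signChar_add, signChar_sum, signChar_sum]
  simp only [sDiag_pow_apply_add, prod_mul_distrib]
  have h : ∏ p : Fin n × Fin n with p.1 < p.2,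
      signChar (A p.1 p.2 * ((x + y) p.1 * (x + y) p.2)) =
      (∏ p : Fin n × Fin n with p.1 < p.2, signChar (A p.1 p.2 * (x p.1 * x p.2))) *
      (∏ p : Fin n × Fin n with p.1 < p.2, signChar (A p.1 p.2 * (y p.1 * y p.2))) *
      ∏ p : Fin n × Fin n with p.1 < p.2,
        signChar (A p.1 p.2 * (x p.1 * y p.2 + y p.1 * x p.2)) := by
    rw [← prod_mul_distrib, ← prod_mul_distrib]
    refine prod_congr rfl fun p _ => ?_
    rw [← signChar_add, ← signChar_add, Pi.add_apply, Pi.add_apply]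
    congr 1
    ring
  rw [h]
  ring

theorem hadamard_conj_pauliZ : star hadamard * pauliZ * hadamard = pauliX := by
  have h : ((Real.sqrt 2 : ℝ) : ℂ)⁻¹ * ((Real.sqrt 2 : ℝ) : ℂ)⁻¹ = 1 / 2 := by
    rw [← mul_inv, ← Complex.ofReal_mul, Real.mul_self_sqrt (by norm_num)]
    norm_num
  ext i j
  fin_cases i <;> fin_cases j <;>
    simp [hadamard, pauliX, pauliZ, Matrix.mul_apply, Matrix.star_apply, h] <;> norm_num

theorem hadamard_conj_pow (b : ZMod 2) :
    star hadamard * pauliZ ^ b.val * hadamard = pauliMat b 0 := by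
  rcases zmod_two_cases b with rfl | rfl
  · simp [pauliMat, hadamard_star_mul]
  · rw [show ZMod.val (1 : ZMod 2) = 1 from rfl, pow_one, hadamard_conj_pauliZ]
    simp [pauliMat]

theorem phaseUnitary_conj_zString {n : ℕ} (A : Matrix (Fin n) (Fin n) (ZMod 2))
    (b : Fin n → ZMod 2) :
    star (phaseUnitary A : Op n) * zString b * (phaseUnitary A : Op n) =
      diagonal (star (phaseDiag A)) * pauliString b 0 * diagonal (phaseDiag A) := by
  have h : star (tensor fun _ : Fin n => hadamard) * zString b * tensor (fun _ => hadamard)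
      = pauliString b 0 := by
    rw [star_tensor, zString, tensor_mul, tensor_mul, pauliString]
    simp only [hadamard_conj_pow, Pi.zero_apply]
  rw [← h]
  simp only [phaseUnitary, star_mul, mul_assoc]
  rw [Matrix.star_eq_conjTranspose (diagonal _), Matrix.diagonal_conjTranspose]

theorem pauliString_zero_right_apply {n : ℕ} (b t s : Fin n → ZMod 2) :
    pauliString b 0 (bits t) (bits s) = if t = s + b then 1 else 0 := by
  obtain ⟨κ, -, h⟩ := isWeyl_pauliString b 0
  have h1 : pauliString b 0 (bits b) (bits 0) = 1 := by
    have h2 : ∀ β : ZMod 2, pauliMat β 0 (toBit β) (toBit 0) = 1 := fun β => by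
      rcases zmod_two_cases β with rfl | rfl <;>
        simp [pauliMat_zero_zero, pauliMat_one_zero, pauliX, toBit_zero, toBit_one]
    rw [pauliString_apply]
    exact prod_eq_one fun i _ => h2 (b i)
  rw [h] at h1 ⊢
  simp only [zero_add, if_true, zero_dotProduct, signChar_zero, mul_one] at h1 ⊢
  rw [h1]

/-- The Hadamards turn `Z^b` into `X^b`. Conjugating by the diagonal `D` multiplies the entry at `(s
+ b, s)` by `conj (D (s + b)) * D s`, which by `phaseDiag_add` is a constant times the character
`(-1)^((A b) ⬝ s)`. -/
theorem isWeyl_phaseUnitary_conj {n : ℕ} {A : Matrix (Fin n) (Fin n) (ZMod 2)} (hA : A.IsSymm)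
    (b : Fin n → ZMod 2) :
    IsWeyl (star (phaseUnitary A : Op n) * zString b * (phaseUnitary A : Op n)) b (A *ᵥ b) := by
  have hd : ∀ s, star (phaseDiag A s) * phaseDiag A s = 1 :=
    fun s => congrFun (star_mul_phaseDiag A) s
  refine ⟨star (phaseDiag A (bits b)), left_ne_zero_of_mul_eq_one (hd (bits b)), fun t s => ?_⟩
  rw [phaseUnitary_conj_zString, Matrix.mul_diagonal, Matrix.diagonal_mul,
    pauliString_zero_right_apply]
  split_ifs with h
  · subst h
    have hr : star (signChar ((A *ᵥ b) ⬝ᵥ s)) = signChar ((A *ᵥ b) ⬝ᵥ s) := by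
      unfold signChar; split_ifs <;> simp
    rw [Pi.star_apply, phaseDiag_add hA, star_mul', star_mul', hr]
    linear_combination star (phaseDiag A (bits b)) * signChar ((A *ᵥ b) ⬝ᵥ s) *
      hd (bits s)
  · simp

/-! ### Shared stabilizers and the graph of `A` -/

theorem phase_ne_zero {c : ℂ} (hc : c ∈ ({1, -1, Complex.I, -Complex.I} : Set ℂ)) : c ≠ 0 := by
  simp only [Set.mem_insert_iff, Set.mem_singleton_iff] at hc
  rcases hc with rfl | rfl | rfl | rfl <;> simp

theorem phase_inv_mul {c d : ℂ} (hc : c ∈ ({1, -1, Complex.I, -Complex.I} : Set ℂ))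
    (hd : d ∈ ({1, -1, Complex.I, -Complex.I} : Set ℂ)) :
    c⁻¹ * d ∈ ({1, -1, Complex.I, -Complex.I} : Set ℂ) := by
  simp only [Set.mem_insert_iff, Set.mem_singleton_iff] at hc hd ⊢
  rcases hc with rfl | rfl | rfl | rfl <;> rcases hd with rfl | rfl | rfl | rfl <;> simp

theorem IsPhaselessOf.exists_isWeyl {n : ℕ} {M P : Op n} (h : IsPhaselessOf M P) :
    ∃ x z, P = pauliString x z ∧ IsWeyl M x z := by
  obtain ⟨hP, c, hc, rfl⟩ := h
  obtain ⟨x, z, rfl⟩ := exists_eq_pauliString hP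
  exact ⟨x, z, rfl, (isWeyl_pauliString x z).smul (phase_ne_zero hc)⟩

theorem IsPhaselessOf.unique {n : ℕ} {M P P' : Op n} (h : IsPhaselessOf M P)
    (h' : IsPhaselessOf M P') : P = P' := by
  obtain ⟨x, z, rfl, hw⟩ := h.exists_isWeyl
  obtain ⟨x', z', rfl, hw'⟩ := h'.exists_isWeyl
  obtain ⟨rfl, rfl⟩ := hw.unique hw'
  rfl

theorem isWeyl_zString {n : ℕ} (a : Fin n → ZMod 2) : IsWeyl (zString a) 0 a := by
  rw [zString_eq_pauliString]
  exact isWeyl_pauliString 0 a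

theorem coe_mul_star {n : ℕ} (V : Unitary n) : (V : Op n) * star (V : Op n) = 1 :=
  Matrix.mem_unitaryGroup_iff.1 V.2

theorem star_mul_coe {n : ℕ} (V : Unitary n) : star (V : Op n) * (V : Op n) = 1 :=
  Matrix.mem_unitaryGroup_iff'.1 V.2

theorem conj_eq_iff {n : ℕ} (V : Unitary n) (M N : Op n) :
    (V : Op n) * M * star (V : Op n) = N ↔ M = star (V : Op n) * N * (V : Op n) := by
  constructor
  · rintro rfl
    simp only [mul_assoc, star_mul_coe, mul_one]
    rw [← mul_assoc, star_mul_coe, one_mul]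
  · rintro rfl
    simp only [mul_assoc, coe_mul_star, mul_one]
    rw [← mul_assoc, coe_mul_star, one_mul]

theorem mem_sharedSubspace_iff {n : ℕ} (U V : Unitary n) (a : Fin n → ZMod 2) :
    a ∈ sharedSubspace U V ↔ ∃ b, ∃ c ∈ ({1, -1, Complex.I, -Complex.I} : Set ℂ),
      star (V : Op n) * zString a * (V : Op n) =
        c • (star (U : Op n) * zString b * (U : Op n)) := by
  have e : ∀ (b : Fin n → ZMod 2) (c : ℂ),
      ((U : Op n) * star (V : Op n) * zString a * (V : Op n) * star (U : Op n) = c • zString b ↔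
      star (V : Op n) * zString a * (V : Op n) =
        c • (star (U : Op n) * zString b * (U : Op n))) := fun b c => by
    have h := conj_eq_iff U (star (V : Op n) * zString a * (V : Op n)) (c • zString b)
    rw [mul_smul_comm, smul_mul_assoc] at h
    simpa only [mul_assoc] using h
  constructor
  · rintro ⟨_, ⟨b, rfl⟩, -, c, hc, h⟩
    exact ⟨b, c, hc, (e b c).1 h⟩
  · rintro ⟨b, c, hc, h⟩
    exact ⟨_, ⟨b, rfl⟩, zString_mem b, c, hc, (e b c).2 h⟩

/-- Undoing the conjugation makes `Z^a` and `Z^b` proportional, and labels are unique. -/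
theorem eq_of_conj_zString_smul {n : ℕ} (V : Unitary n) {a b : Fin n → ZMod 2} {c d : ℂ} {P : Op n}
    (hc : c ≠ 0) (hd : d ≠ 0) (ha : star (V : Op n) * zString a * (V : Op n) = c • P)
    (hb : star (V : Op n) * zString b * (V : Op n) = d • P) : a = b := by
  have ha' := (conj_eq_iff V _ _).2 ha.symm
  have hb' := (conj_eq_iff V _ _).2 hb.symm
  rw [mul_smul_comm, smul_mul_assoc] at ha' hb'
  have hP : zString a = (c * d⁻¹) • zString b := by
    rw [← ha', ← hb', smul_smul, inv_mul_cancel_right₀ hd]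
  have hw := (isWeyl_zString b).smul (mul_ne_zero hc (inv_ne_zero hd))
  rw [← hP] at hw
  exact ((isWeyl_zString a).unique hw).2

theorem exists_isPhaselessOf_conj {n : ℕ} {V : Unitary n} (hV : IsClifford V)
    (a : Fin n → ZMod 2) :
    ∃ P, IsPhaselessOf (star (V : Op n) * zString a * (V : Op n)) P :=
  hV _ ⟨zString a, zString_mem a, 1, by simp, (one_smul _ _).symm⟩

theorem natCard_sharedSubspace {n : ℕ} (U V : Unitary n) :
    (sharedSubspace U V : Set (Fin n → ZMod 2)).ncard = 2 ^ nG U V := by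
  rw [nG, ← Nat.card_coe_set_eq]
  exact (Module.natCard_eq_pow_finrank (K := ZMod 2)).trans (by rw [Nat.card_zmod]; rfl)

theorem ncard_phaselessStabilizers_inter {n : ℕ} (U : Unitary n) {V : Unitary n}
    (hV : IsClifford V) :
    (phaselessStabilizers U ∩ phaselessStabilizers V).ncard = 2 ^ nG U V := by
  rw [← natCard_sharedSubspace]
  symm
  choose f hf using exists_isPhaselessOf_conj hV
  -- The bijection sends `a` to `[V† Z^a V]`, which exists because `V` is Clifford.
  refine Set.ncard_congr (fun a _ => f a) ?_ ?_ ?_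
  · intro a ha
    obtain ⟨b, c, hc, h⟩ := (mem_sharedSubspace_iff U V a).1 ha
    refine ⟨⟨_, ⟨b, rfl⟩, (hf a).1, ?_⟩, _, ⟨a, rfl⟩, hf a⟩
    obtain ⟨-, d, hd, h'⟩ := hf a
    refine ⟨c⁻¹ * d, phase_inv_mul hc hd, ?_⟩
    rw [mul_smul, ← h', h, smul_smul, inv_mul_cancel₀ (phase_ne_zero hc), one_smul]
  · intro a b _ _ h
    obtain ⟨-, c, hc, ha⟩ := hf a
    obtain ⟨-, d, hd, hb⟩ := hf b
    rw [← show f a = f b from h] at hb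
    exact eq_of_conj_zString_smul V (phase_ne_zero hc) (phase_ne_zero hd) ha hb
  · rintro P ⟨⟨_, ⟨b, rfl⟩, -, c, hc, hb⟩, _, ⟨a, rfl⟩, ha⟩
    refine ⟨a, ?_, (hf a).unique ha⟩
    obtain ⟨-, d, hd, ha⟩ := ha
    refine (mem_sharedSubspace_iff U V a).2 ⟨b, c⁻¹ * d, phase_inv_mul hc hd, ?_⟩
    simp only at ha hb
    rw [ha, hb, smul_smul, mul_comm, ← mul_assoc, mul_inv_cancel₀ (phase_ne_zero hc), one_mul]

/-- The `2 ^ n` Weyl labels of the stabilizers of a Clifford unitary contain the labels shared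
with each phase unitary, which lie on the graph of its matrix. -/
theorem exists_graph_bound {n : ℕ} {V : Unitary n} (hV : IsClifford V) :
    ∃ T : Finset ((Fin n → ZMod 2) × (Fin n → ZMod 2)), #T ≤ 2 ^ n ∧
      ∀ A : SymMat n, 2 ^ nG (phaseUnitary A.1) V ≤ #{p ∈ T | A.1 *ᵥ p.1 = p.2} := by
  choose f hf using exists_isPhaselessOf_conj hV
  choose x z hxz hw using fun a => (hf a).exists_isWeyl
  -- The labels of the stabilizers of `V`: the set does not depend on `A`, so it can be fixed before
  -- averaging.
  refine ⟨univ.image fun a => (x a, z a), card_image_le.trans (by simp), fun A => ?_⟩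
  rw [← natCard_sharedSubspace, ← Set.ncard_coe_finset]
  refine Set.ncard_le_ncard_of_injOn (fun a => (x a, z a)) (fun a ha => ?_) (fun a _ b _ h => ?_)
    (Finset.finite_toSet _)
  · obtain ⟨b, c, hc, h⟩ := (mem_sharedSubspace_iff _ V a).1 ha
    have hw' := (isWeyl_phaseUnitary_conj A.2 b).smul (phase_ne_zero hc)
    rw [← h] at hw'
    obtain ⟨h1, h2⟩ := (hw a).unique hw'
    simp only [coe_filter, mem_image, mem_univ, true_and, Set.mem_ofPred_eq, exists_apply_eq_apply]
    rw [h1, h2]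
  · obtain ⟨h1, h2⟩ := Prod.mk.inj h
    have hP : f a = f b := by rw [hxz, hxz, h1, h2]
    obtain ⟨-, c, hc, ha⟩ := hf a
    obtain ⟨-, d, hd, hb⟩ := hf b
    rw [← hP] at hb
    exact eq_of_conj_zString_smul V (phase_ne_zero hc) (phase_ne_zero hd) ha hb

/-! ### Moments and the tail bound -/

theorem tsum_map_mul {α β : Type*} (p : PMF α) (g : α → β) (f : β → ℝ≥0∞) :
    ∑' b, p.map g b * f b = ∑' a, p a * f (g a) := by
  classical
  simp only [PMF.map_apply, ← ENNReal.tsum_mul_right]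
  rw [ENNReal.tsum_comm]
  refine tsum_congr fun a => ?_
  rw [tsum_eq_single (g a) fun b hb => by rw [if_neg hb, zero_mul], if_pos rfl]

theorem second_moment_le {n : ℕ} {V : Unitary n} (hV : IsClifford V) :
    ∑' U : Unitary n, phaseEnsemble n U * (4 : ℝ≥0∞) ^ nG U V ≤ 8 := by
  obtain ⟨T, hT, h⟩ := exists_graph_bound hV
  have h1 : ∑ A : SymMat n, 4 ^ nG (phaseUnitary A.1) V ≤ 8 * Fintype.card (SymMat n) := by
    refine le_trans (sum_le_sum fun A _ => ?_) (sum_card_graph_sq_le T hT)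
    rw [show 4 = 2 ^ 2 by rfl, pow_right_comm]
    exact Nat.pow_le_pow_left (h A) 2
  have h2 : ∑ A : SymMat n, (4 : ℝ≥0∞) ^ nG (phaseUnitary A.1) V
      ≤ 8 * (Fintype.card (SymMat n) : ℝ≥0∞) := by exact_mod_cast h1
  rw [phaseEnsemble, tsum_map_mul, tsum_fintype]
  simp only [PMF.uniformOfFintype_apply]
  rw [← mul_sum, mul_comm, ← div_eq_mul_inv]
  exact ENNReal.div_le_of_le_mul h2

end PhaseShadow

theorem mainTheorem7 :
    ∃ C : ℝ≥0, ∀ (n : ℕ) (V : PhaseShadow.Unitary n), PhaseShadow.IsClifford V →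
      -- the number of shared phaseless stabilizers is `2 ^ n_g(U, V)`
      (∀ U ∈ (PhaseShadow.phaseEnsemble n).support,
        (PhaseShadow.phaselessStabilizers U ∩ PhaseShadow.phaselessStabilizers V).ncard
          = 2 ^ PhaseShadow.nG U V) ∧
      -- expectation
      (∑' U : PhaseShadow.Unitary n,
        PhaseShadow.phaseEnsemble n U * (2 : ℝ≥0∞) ^ PhaseShadow.nG U V ≤ (C : ℝ≥0∞)) ∧
      -- tail bound
      (∀ c : ℝ, 0 < c →
        (PhaseShadow.phaseEnsemble n).toOuterMeasure
            {U | (2 : ℝ) ^ c ≤ (2 : ℝ) ^ PhaseShadow.nG U V}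
          ≤ (C : ℝ≥0∞) * ENNReal.ofReal ((2 : ℝ) ^ (-2 * c))) := by
  refine ⟨8, fun n V hV => ⟨fun U _ => PhaseShadow.ncard_phaselessStabilizers_inter U hV, ?_, ?_⟩⟩
  · refine le_trans (ENNReal.tsum_le_tsum fun U => ?_) (PhaseShadow.second_moment_le hV)
    gcongr
    norm_num
  · intro c _
    rw [PMF.toOuterMeasure_apply]
    -- Markov's inequality for `4 ^ n_g`: on the event, `4 ^ n_g * 2 ^ (-2 * c) ≥ 1`, so the
    -- indicator is dominated pointwise.
    refine le_trans ?_ (mul_le_mul_left (PhaseShadow.second_moment_le hV) _)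
    rw [← ENNReal.tsum_mul_right]
    refine ENNReal.tsum_le_tsum fun U => ?_
    by_cases hU : U ∈ {U | (2 : ℝ) ^ c ≤ (2 : ℝ) ^ PhaseShadow.nG U V}
    swap
    · rw [Set.indicator_of_notMem hU]
      exact zero_le
    rw [Set.indicator_of_mem hU]
    have hreal : 1 ≤ (4 : ℝ) ^ PhaseShadow.nG U V * (2 : ℝ) ^ (-2 * c) := by
      have e : (2 : ℝ) ^ (-2 * c) = (((2 : ℝ) ^ c) ^ 2)⁻¹ := by
        rw [← Real.rpow_natCast, ← Real.rpow_mul (by norm_num), ← Real.rpow_neg (by norm_num)]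
        congr 1
        push_cast
        ring
      rw [e, ← div_eq_mul_inv, one_le_div (by positivity), show (4 : ℝ) = 2 ^ 2 by norm_num,
        pow_right_comm]
      exact pow_le_pow_left₀ (by positivity) hU 2
    have hE := ENNReal.ofReal_le_ofReal hreal
    rw [ENNReal.ofReal_mul (by positivity), ENNReal.ofReal_pow (by norm_num), ENNReal.ofReal_one,
      ENNReal.ofReal_ofNat] at hE
    rw [mul_assoc]
    exact le_mul_of_one_le_right zero_le hE
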